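/- Let $(\Omega,\mathcal A,\mathbb P)$ be a probability space, let $1<p<\infty$, and write $L^q=L^q(\Omega,\mathcal A,\mathbb P;\mathbb R)$. Let $\psi:[1,\infty)\to(0,\infty)$ be a nondecreasing function for which there is a constant $C>1$ such that $\psi(2x)\le C\psi(x)$ for every $x\ge 1$. Let $$L^{p,w}=\Big\{g\in L^1:\ \sup_{\lambda>0}\lambda^p\,\mathbb P\{|g|\ge\lambda\}<\infty\Big\}$$ denote the weak $L^p$ space. (i) Let $T$ be a Dunford–Schwartz operator, that is, a linear operator on $L^1$ that is a contraction of $L^1$ and whose restriction to $L^\infty$ is a contraction of $L^\infty$. Let $f\in L^p$ satisfy $$\sum_{n\ge1}\frac{\|f+Tf+\dots+T^{n-1}f\|_p}{\psi(n)\,n^{1+1/p}}<\infty .$$ Then $\displaystyle\sup_{n\ge1}\frac{|f+Tf+\dots+T^{n-1}f|}{\psi(n)\,n^{1/p}}$ is finite $\mathbb P$-almost surely and belongs to $L^{p,w}$, and $$\frac{|f+Tf+\dots+T^{n-1}f|}{\psi(n)\,n^{1/p}}\longrightarrow 0\quad\text{as } n\to\infty,\quad \mathbb P\text{-almost surely.}$$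 (ii) Let $\theta:\Omega\to\Omega$ be a measurable transformation preserving $\mathbb P$, let $(\mathcal B,|\cdot|_{\mathcal B})$ be a real Banach space, and let $Tf=f\circ\theta$. Let $f:\Omega\to\mathcal B$ belong to the Bochner space $L^p(\mathcal B)$, with norm $\|f\|_{p,\mathcal B}=(\mathbb E|f|_{\mathcal B}^p)^{1/p}$, and satisfy $$\sum_{n\ge1}\frac{\|f+Tf+\dots+T^{n-1}f\|_{p,\mathcal B}}{\psi(n)\,n^{1+1/p}}<\infty .$$ Then $\displaystyle\sup_{n\ge1}\frac{|f+Tf+\dots+T^{n-1}f|_{\mathcal B}}{\psi(n)\,n^{1/p}}$ is finite $\mathbb P$-almost surely and belongs to $L^{p,w}$, and $$\frac{|f+Tf+\dots+T^{n-1}f|_{\mathcal B}}{\psi(n)\,n^{1/p}}\longrightarrow 0\quad\text{as } n\to\infty,\quad \mathbb P\text{-almost surely.}$$ -/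

import Mathlib

open MeasureTheory Filter Topology
open scoped ENNReal

namespace DunfordSchwartz

variable {Ω : Type*} [MeasurableSpace Ω]

/-- A Dunford–Schwartz operator: a linear operator on (real) `L¹` which is a contraction of `L¹`
and a contraction of `L^∞`. On a probability space `L^∞ ⊆ L¹`, so the second condition is about the
restriction of `T` to `L^∞`; it is void for `f ∉ L^∞`, where the right-hand side is `∞`. -/
structure IsDunfordSchwartz (μ : Measure Ω) (T : Lp ℝ 1 μ →L[ℝ] Lp ℝ 1 μ) : Prop where
  contraction_one : ∀ f : Lp ℝ 1 μ, ‖T f‖ ≤ ‖f‖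
  contraction_top : ∀ f : Lp ℝ 1 μ, eLpNorm (T f) ∞ μ ≤ eLpNorm f ∞ μ

/-- Membership in the weak `L^p` space
`{g ∈ L¹ : sup_{t > 0} t^p μ{|g| ≥ t} < ∞}`. -/
def MemWeakLp (μ : Measure Ω) (p : ℝ) (g : Ω → ℝ) : Prop :=
  Integrable g μ ∧
    (⨆ (t : ℝ) (_ : 0 < t), ENNReal.ofReal (t ^ p) * μ {ω | t ≤ |g ω|}) < ∞

/-- `U_n(f) = f + T f + ⋯ + T^{n-1} f`. -/
noncomputable def partialSum {μ : Measure Ω} (T : Lp ℝ 1 μ →L[ℝ] Lp ℝ 1 μ) (f : Lp ℝ 1 μ)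
    (n : ℕ) : Lp ℝ 1 μ :=
  ∑ k ∈ Finset.range n, (T ^ k) f

/-- `∑_{n ≥ 1} ‖V_n‖_p / (ψ(n) n^{1+1/p}) < ∞`, as a series in `[0, ∞]`. -/
def SummableNorms {E : Type*} [NormedAddCommGroup E] (μ : Measure Ω) (p : ℝ) (ψ : ℝ → ℝ)
    (V : ℕ → Ω → E) : Prop :=
  (∑' n : ℕ, eLpNorm (V (n + 1)) (ENNReal.ofReal p) μ /
    ENNReal.ofReal (ψ ((n + 1 : ℕ) : ℝ) * ((n + 1 : ℕ) : ℝ) ^ (1 + 1 / p))) < ∞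

/-- `|V_n(ω)| / (ψ(n) n^{1/p})`. -/
noncomputable def rateQuotient {E : Type*} [NormedAddCommGroup E] (p : ℝ) (ψ : ℝ → ℝ)
    (V : ℕ → Ω → E) (n : ℕ) (ω : Ω) : ℝ :=
  ‖V n ω‖ / (ψ (n : ℝ) * (n : ℝ) ^ (1 / p))

end DunfordSchwartz

open DunfordSchwartz

/-! Both parts concern a cocycle `V (n + m) = V n + W n m`, where `W n m` is `V m` moved by the
`n`-th power of the dynamics. The only other dynamical input is `TailDominated`: truncating `V m` at
level `t` splits its image into a part bounded by `t` and a part controlled in `L¹` by the values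
above `t`.

Chaining along the binary digits of `n` writes `V n` as a sum of blocks `W (2^(k+1) * j) (2^k)` with
`2^k * (j + 1) ≤ n`. Hence `‖V n‖ / (ψ n * n^(1/p))` is at most the sum over `k` of `(ψ (2^k) *
2^(k/p))⁻¹` times the supremum over `j` of `‖W (2^(k+1) * j) (2^k)‖ / (j + 1)^(1/p)`. This sum is
`chainBound`.

Summing the tails over `j` shows that each supremum has weak `L^p` size at most a constant times `‖V
(2^k)‖_p` (`TailDominated.measure_lt_iSup_le`). For `p > 1` weak `L^p` carries an equivalent norm,
so these bounds may be added over `k`. The resulting dyadic series converges because the norms are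
almost subadditive (`tsum_two_pow_le`). For the limit, Borel–Cantelli makes each block quotient
vanish as `j → ∞`, and dominated convergence in `k` concludes (`chain_rate`). -/

namespace DunfordSchwartz

variable {Ω : Type*} [MeasurableSpace Ω]

/-! ### Tail domination and summation of tails at the levels `(j + 1)^(1/p)`. -/

section Tail

/-- A discrete form of comparison with the integral of `x^(-1/p)`; the induction step is Bernoulli's
inequality for `(1 - 1/(n+1))^(1 - 1/p)`. -/
theorem sum_rpow_neg_le {p : ℝ} (hp : 1 < p) (N : ℕ) :
    ∑ j ∈ Finset.range N, (((j : ℝ) + 1) ^ (1 / p))⁻¹ ≤ p / (p - 1) * (N : ℝ) ^ (1 - 1 / p) := by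
  have hp0 : 0 < p := by linarith
  have hp1 : 0 < p - 1 := by linarith
  have hr0 : 0 < 1 - 1 / p := by
    rw [sub_pos, div_lt_one hp0]; exact hp
  have hr1 : 1 - 1 / p ≤ 1 := by
    have : 0 < 1 / p := by positivity
    linarith
  induction N with
  | zero => simp only [Finset.range_zero, Finset.sum_empty]; positivity
  | succ n ih =>
    rw [Finset.sum_range_succ]
    have hn : (0 : ℝ) < (n : ℝ) + 1 := by positivity
    have hs : -1 ≤ -((n : ℝ) + 1)⁻¹ := by
      have : ((n : ℝ) + 1)⁻¹ ≤ 1 := inv_le_one_of_one_le₀ (by linarith [n.cast_nonneg (α := ℝ)])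
      linarith
    have hb := rpow_one_add_le_one_add_mul_self hs hr0.le hr1
    have hmul : (n : ℝ) ^ (1 - 1 / p)
        = ((n : ℝ) + 1) ^ (1 - 1 / p) * (1 + -((n : ℝ) + 1)⁻¹) ^ (1 - 1 / p) := by
      rw [← Real.mul_rpow hn.le (by linarith)]
      congr 1; field_simp; ring
    have hinv : (((n : ℝ) + 1) ^ (1 / p))⁻¹
        = ((n : ℝ) + 1) ^ (1 - 1 / p) * ((n : ℝ) + 1)⁻¹ := by
      rw [Real.rpow_sub hn, Real.rpow_one]; field_simp
    have hpos : 0 < ((n : ℝ) + 1) ^ (1 - 1 / p) := by positivity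
    have hq : p / (p - 1) * (1 - 1 / p) = 1 := by field_simp
    have h1 : (n : ℝ) ^ (1 - 1 / p)
        ≤ ((n : ℝ) + 1) ^ (1 - 1 / p) * (1 + (1 - 1 / p) * -((n : ℝ) + 1)⁻¹) := by
      rw [hmul]; gcongr
    have h2 := mul_le_mul_of_nonneg_left h1 (show 0 ≤ p / (p - 1) by positivity)
    push_cast
    rw [hinv]
    have h3 : p / (p - 1) * (((n : ℝ) + 1) ^ (1 - 1 / p) * (1 + (1 - 1 / p) * -((n : ℝ) + 1)⁻¹))
        = p / (p - 1) * ((n : ℝ) + 1) ^ (1 - 1 / p)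
          - (p / (p - 1) * (1 - 1 / p)) * (((n : ℝ) + 1) ^ (1 - 1 / p) * ((n : ℝ) + 1)⁻¹) := by
      ring
    rw [h3, hq, one_mul] at h2
    linarith

theorem ofReal_succ_rpow (j : ℕ) {r : ℝ} (hr : 0 ≤ r) :
    ((j : ℝ≥0∞) + 1) ^ r = ENNReal.ofReal (((j : ℝ) + 1) ^ r) := by
  rw [← ENNReal.ofReal_rpow_of_nonneg (by positivity) hr, ENNReal.ofReal_add (by positivity) (by simp)]
  simp

theorem succ_rpow_ne_zero (j : ℕ) (r : ℝ) : ((j : ℝ≥0∞) + 1) ^ r ≠ 0 := by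
  intro h
  rcases ENNReal.rpow_eq_zero_iff.1 h with h | h
  · simp at h
  · exact absurd h.1 (by simp)

theorem succ_rpow_ne_top (j : ℕ) (r : ℝ) : ((j : ℝ≥0∞) + 1) ^ r ≠ ∞ :=
  ENNReal.rpow_ne_top_of_ne_zero (by simp) (by simp)

/-- Only indices with `j + 1 < y^p` contribute, and over them `(j + 1)^(-1/p)` sums to at most a
constant times `y^(p-1)`. -/
theorem tsum_ite_div_le {p : ℝ} (hp : 1 < p) (y : ℝ≥0∞) :
    ∑' j : ℕ, (if ((j : ℝ≥0∞) + 1) ^ (1 / p) < y then y / ((j : ℝ≥0∞) + 1) ^ (1 / p) else 0)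
      ≤ ENNReal.ofReal (p / (p - 1)) * y ^ p := by
  have hp0 : 0 < p := by linarith
  have hp1 : 0 < p - 1 := by linarith
  rcases eq_or_ne y ∞ with rfl | hy
  · rw [ENNReal.top_rpow_of_pos hp0, ENNReal.mul_top]
    · exact le_top
    · simp; positivity
  obtain ⟨x, hx, rfl⟩ : ∃ x : ℝ, 0 ≤ x ∧ y = ENNReal.ofReal x :=
    ⟨y.toReal, ENNReal.toReal_nonneg, (ENNReal.ofReal_toReal hy).symm⟩
  rw [ENNReal.ofReal_rpow_of_nonneg hx hp0.le, ← ENNReal.ofReal_mul (by positivity)]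
  rw [tsum_eq_sum (s := Finset.range ⌊x ^ p⌋₊)]
  · calc _ ≤ ∑ j ∈ Finset.range ⌊x ^ p⌋₊, ENNReal.ofReal (x * (((j : ℝ) + 1) ^ (1 / p))⁻¹) := by
          refine Finset.sum_le_sum fun j _ => ?_
          rw [ofReal_succ_rpow j (by positivity)]
          split_ifs
          · rw [ENNReal.ofReal_mul hx, ENNReal.ofReal_inv_of_pos (by positivity), div_eq_mul_inv]
          · simp
      _ = ENNReal.ofReal (x * ∑ j ∈ Finset.range ⌊x ^ p⌋₊, (((j : ℝ) + 1) ^ (1 / p))⁻¹) := by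
          rw [Finset.mul_sum, ENNReal.ofReal_sum_of_nonneg]
          intros; positivity
      _ ≤ _ := by
          refine ENNReal.ofReal_le_ofReal ?_
          have h1 := sum_rpow_neg_le hp ⌊x ^ p⌋₊
          have hr0 : 0 ≤ 1 - 1 / p := by
            rw [sub_nonneg, div_le_one hp0]; exact hp.le
          have h2 : (⌊x ^ p⌋₊ : ℝ) ^ (1 - 1 / p) ≤ x ^ (p - 1) := by
            calc (⌊x ^ p⌋₊ : ℝ) ^ (1 - 1 / p) ≤ (x ^ p) ^ (1 - 1 / p) :=
                  Real.rpow_le_rpow (by positivity) (Nat.floor_le (by positivity)) hr0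
              _ = _ := by
                  rw [← Real.rpow_mul hx]; congr 1; field_simp
          calc _ ≤ x * (p / (p - 1) * x ^ (p - 1)) := by
                gcongr
                exact h1.trans (by gcongr)
            _ = p / (p - 1) * x ^ p := by
                rcases hx.eq_or_lt with rfl | hx'
                · simp [Real.zero_rpow hp0.ne']
                · rw [Real.rpow_sub_one hx'.ne']; field_simp
  · intro j hj
    rw [if_neg]
    rw [Finset.mem_range, not_lt] at hj
    rw [not_lt, ofReal_succ_rpow j (by positivity)]
    refine ENNReal.ofReal_le_ofReal ?_
    have h1 : x ^ p < (j : ℝ) + 1 := (Nat.lt_floor_add_one _).trans_le (by gcongr)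
    calc x = (x ^ p) ^ (1 / p) := by
          rw [← Real.rpow_mul hx, mul_one_div_cancel hp0.ne', Real.rpow_one]
      _ ≤ _ := Real.rpow_le_rpow (by positivity) h1.le (by positivity)

/-- A discrete layer-cake bound: for finite `y` the series counts the integers in `[1, y^p]`, and
the `1` pays for rounding down. -/
theorem rpow_le_one_add_tsum {p : ℝ} (hp : 0 < p) (y : ℝ≥0∞) :
    y ^ p ≤ 1 + ∑' j : ℕ, (if ((j : ℝ≥0∞) + 1) ^ (1 / p) ≤ y then 1 else 0) := by
  rcases eq_or_ne y ∞ with rfl | hy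
  · simp
  have hyp : y ^ p ≠ ∞ := ENNReal.rpow_ne_top_of_nonneg hp.le hy
  obtain ⟨x, hx⟩ : ∃ x : NNReal, (x : ℝ≥0∞) = y ^ p := ⟨(y ^ p).toNNReal, ENNReal.coe_toNNReal hyp⟩
  have h1 : x ≤ ⌊x⌋₊ + 1 := (Nat.lt_floor_add_one x).le
  calc y ^ p = x := hx.symm
    _ ≤ 1 + ∑ j ∈ Finset.range ⌊x⌋₊, (1 : ℝ≥0∞) := by
        rw [add_comm]; simp only [Finset.sum_const, Finset.card_range, nsmul_eq_mul, mul_one]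
        exact_mod_cast h1
    _ = 1 + ∑ j ∈ Finset.range ⌊x⌋₊, (if ((j : ℝ≥0∞) + 1) ^ (1 / p) ≤ y then 1 else 0) := by
        congr 1
        refine Finset.sum_congr rfl fun j hj => (if_pos ?_).symm
        rw [Finset.mem_range] at hj
        rw [one_div, ENNReal.rpow_inv_le_iff hp, ← hx]
        have : ((j + 1 : ℕ) : NNReal) ≤ x := (Nat.le_floor_iff (by positivity)).1 hj
        exact_mod_cast this
    _ ≤ _ := by gcongr; exact ENNReal.sum_le_tsum _

/-- The tails of `h` are controlled by those of `g` in the way an `L¹`-`L^∞` contraction does. -/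
def TailDominated (μ : Measure Ω) (h g : Ω → ℝ≥0∞) : Prop :=
  ∀ t : ℝ≥0∞, t ≠ 0 → t ≠ ∞ →
    μ {ω | 2 * t ≤ h ω} ≤ ∫⁻ ω, {x | t < g x}.indicator (fun x => g x / t) ω ∂μ

variable {μ : Measure Ω} {p : ℝ}

/-- The functions `h j` may vary with `j` because only the common majorant `g` enters: the tail
bounds are summed under one integral and `tsum_ite_div_le` is applied with `y = g ω / t`. -/
theorem TailDominated.tsum_measure_le (hp : 1 < p) {h : ℕ → Ω → ℝ≥0∞} {g : Ω → ℝ≥0∞}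
    (hg : AEMeasurable g μ) (hD : ∀ j, TailDominated μ (h j) g) {t : ℝ≥0∞} (ht : t ≠ 0)
    (ht' : t ≠ ∞) :
    ∑' j : ℕ, μ {ω | 2 * (t * ((j : ℝ≥0∞) + 1) ^ (1 / p)) ≤ h j ω}
      ≤ ENNReal.ofReal (p / (p - 1)) * ∫⁻ ω, (g ω / t) ^ p ∂μ := by
  have hw0 := fun j : ℕ => succ_rpow_ne_zero j (1 / p)
  have hw1 := fun j : ℕ => succ_rpow_ne_top j (1 / p)
  calc _ ≤ ∑' j : ℕ, ∫⁻ ω, {x | t * ((j : ℝ≥0∞) + 1) ^ (1 / p) < g x}.indicator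
        (fun x => g x / (t * ((j : ℝ≥0∞) + 1) ^ (1 / p))) ω ∂μ :=
        ENNReal.tsum_le_tsum fun j => hD j _ (mul_ne_zero ht (hw0 j)) (ENNReal.mul_ne_top ht' (hw1 j))
    _ = ∫⁻ ω, ∑' j : ℕ, {x | t * ((j : ℝ≥0∞) + 1) ^ (1 / p) < g x}.indicator
        (fun x => g x / (t * ((j : ℝ≥0∞) + 1) ^ (1 / p))) ω ∂μ := by
        rw [lintegral_tsum]
        intro j
        exact (hg.div_const _).indicator₀ (nullMeasurableSet_lt aemeasurable_const hg)
    _ ≤ ∫⁻ ω, ENNReal.ofReal (p / (p - 1)) * (g ω / t) ^ p ∂μ := by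
        refine lintegral_mono fun ω => ?_
        refine le_trans (ENNReal.tsum_le_tsum fun j => ?_) (tsum_ite_div_le hp (g ω / t))
        simp only [Set.indicator_apply, Set.mem_ofPred_eq]
        have h1 : t * ((j : ℝ≥0∞) + 1) ^ (1 / p) < g ω ↔ ((j : ℝ≥0∞) + 1) ^ (1 / p) < g ω / t := by
          rw [ENNReal.lt_div_iff_mul_lt (Or.inl ht) (Or.inl ht'), mul_comm]
        simp only [h1]
        split_ifs
        · rw [ENNReal.div_eq_inv_mul, ENNReal.div_eq_inv_mul, ENNReal.div_eq_inv_mul,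
            ENNReal.mul_inv (Or.inl ht) (Or.inl ht'), mul_assoc, mul_left_comm]
        · rfl
    _ = _ := lintegral_const_mul'' _ ((hg.div_const _).pow_const _)

/-- Strong type estimate for a tail dominated function. -/
theorem TailDominated.lintegral_rpow_le [IsProbabilityMeasure μ] (hp : 1 < p)
    {h g : Ω → ℝ≥0∞} (hh : AEMeasurable h μ) (hg : AEMeasurable g μ) (hD : TailDominated μ h g) :
    ∫⁻ ω, h ω ^ p ∂μ ≤ ENNReal.ofReal (p / (p - 1)) * 2 ^ p * ∫⁻ ω, g ω ^ p ∂μ := by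
  have hp0 : 0 < p := by linarith
  refine ENNReal.le_of_forall_pos_le_add fun ε hε _ => ?_
  have hε0 : (ε : ℝ≥0∞) ≠ 0 := by exact_mod_cast hε.ne'
  -- Chosen so that `(2 * t)^p = ε`: after rescaling, the additive `1` from the discrete layer-cake
  -- bound costs only `ε`.
  set t : ℝ≥0∞ := (ε : ℝ≥0∞) ^ (1 / p) / 2 with ht_def
  have ht : t ≠ 0 := by simp [ht_def, hε0, hp0.not_gt]
  have ht' : t ≠ ∞ := by
    refine (ENNReal.div_lt_top (ENNReal.rpow_ne_top_of_nonneg (by positivity) (by simp)) ?_).ne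
    simp
  have h2t : (2 * t) = (ε : ℝ≥0∞) ^ (1 / p) := ENNReal.mul_div_cancel (by simp) (by simp)
  have h2tp : (2 * t) ^ p = ε := by
    rw [h2t, ← ENNReal.rpow_mul, one_div_mul_cancel hp0.ne', ENNReal.rpow_one]
  have h2t0 : 2 * t ≠ 0 := mul_ne_zero (by simp) ht
  have h2t1 : 2 * t ≠ ∞ := ENNReal.mul_ne_top (by simp) ht'
  have key : ∫⁻ ω, (h ω / (2 * t)) ^ p ∂μ
      ≤ 1 + ENNReal.ofReal (p / (p - 1)) * ∫⁻ ω, (g ω / t) ^ p ∂μ := by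
    calc _ ≤ ∫⁻ ω, (1 + ∑' j : ℕ,
          {x | 2 * (t * ((j : ℝ≥0∞) + 1) ^ (1 / p)) ≤ h x}.indicator 1 ω) ∂μ := by
          refine lintegral_mono fun ω => (rpow_le_one_add_tsum hp0 _).trans ?_
          gcongr with j
          simp only [Set.indicator_apply, Set.mem_ofPred_eq, Pi.one_apply]
          simp only [ENNReal.le_div_iff_mul_le (Or.inl h2t0) (Or.inl h2t1),
            mul_comm _ (2 * t), mul_assoc, le_refl]
      _ = 1 + ∑' j : ℕ, μ {ω | 2 * (t * ((j : ℝ≥0∞) + 1) ^ (1 / p)) ≤ h ω} := by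
          have hn : ∀ j : ℕ, NullMeasurableSet
              {ω | 2 * (t * ((j : ℝ≥0∞) + 1) ^ (1 / p)) ≤ h ω} μ :=
            fun j => nullMeasurableSet_le aemeasurable_const hh
          rw [lintegral_add_left measurable_const, lintegral_tsum]
          · simp only [lintegral_const, measure_univ, mul_one]
            congr 2 with j
            exact lintegral_indicator_one₀ (hn j)
          · exact fun j => aemeasurable_const.indicator₀ (hn j)
      _ ≤ _ := by
          gcongr
          exact TailDominated.tsum_measure_le hp (h := fun _ => h) hg (fun _ => hD) ht ht'
  have e1 : ∀ (u : Ω → ℝ≥0∞) (s : ℝ≥0∞), s ≠ 0 → s ≠ ∞ → AEMeasurable u μ →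
      s ^ p * ∫⁻ ω, (u ω / s) ^ p ∂μ = ∫⁻ ω, u ω ^ p ∂μ := by
    intro u s hs hs' hu
    rw [← lintegral_const_mul'' _ ((hu.div_const _).pow_const _)]
    refine lintegral_congr fun ω => ?_
    rw [← ENNReal.mul_rpow_of_nonneg _ _ hp0.le, ENNReal.mul_div_cancel hs hs']
  calc ∫⁻ ω, h ω ^ p ∂μ = (2 * t) ^ p * ∫⁻ ω, (h ω / (2 * t)) ^ p ∂μ := (e1 h _ h2t0 h2t1 hh).symm
    _ ≤ (2 * t) ^ p * (1 + ENNReal.ofReal (p / (p - 1)) * ∫⁻ ω, (g ω / t) ^ p ∂μ) := by gcongr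
    _ = ENNReal.ofReal (p / (p - 1)) * 2 ^ p * (t ^ p * ∫⁻ ω, (g ω / t) ^ p ∂μ) + (2 * t) ^ p := by
        rw [ENNReal.mul_rpow_of_nonneg _ _ hp0.le]; ring
    _ = _ := by rw [e1 g t ht ht' hg, h2tp]

end Tail

/-! ### Weak `L^p` bounds as bounds on integrals over sets. -/

section Weak

variable {μ : Measure Ω} {p : ℝ}

/-- For finite `x > s` the last dyadic level below `x` already suffices; the full sum is used
because its integral involves only tail measures. -/
theorem le_add_tsum_dyadic (x : ℝ≥0∞) {s : ℝ≥0∞} (hs : s ≠ 0) (hs' : s ≠ ∞) :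
    x ≤ s + ∑' i : ℕ, (if 2 ^ i * s < x then 2 ^ (i + 1) * s else 0) := by
  classical
  rcases eq_or_ne x ∞ with rfl | hx
  · have : ∑' _ : ℕ, s ≤ ∑' i : ℕ, (if 2 ^ i * s < ∞ then 2 ^ (i + 1) * s else 0) := by
      refine ENNReal.tsum_le_tsum fun i => ?_
      rw [if_pos (ENNReal.mul_lt_top (by simp) hs'.lt_top)]
      exact le_mul_of_one_le_left zero_le (one_le_pow₀ (by norm_num))
    rw [ENNReal.tsum_const_eq_top_of_ne_zero hs, top_le_iff] at this
    simp [this]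
  have hex : ∃ m : ℕ, x ≤ 2 ^ m * s := by
    obtain ⟨n, hn⟩ := ENNReal.exists_nat_gt (ENNReal.div_lt_top hx hs).ne
    refine ⟨n, ?_⟩
    rw [← ENNReal.div_le_iff hs hs']
    refine hn.le.trans ?_
    exact_mod_cast (Nat.lt_two_pow_self (n := n)).le
  obtain h0 | h0 := Nat.eq_zero_or_pos (Nat.find hex)
  · have := Nat.find_spec hex
    rw [h0, pow_zero, one_mul] at this
    exact this.trans le_self_add
  · obtain ⟨m, hm⟩ := Nat.exists_eq_succ_of_ne_zero h0.ne'
    have h1 := Nat.find_spec hex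
    have h2 := Nat.find_min hex (m := m) (by omega)
    rw [not_le] at h2
    rw [hm] at h1
    calc x ≤ 2 ^ (m + 1) * s := h1
      _ = (if 2 ^ m * s < x then 2 ^ (m + 1) * s else 0) := by rw [if_pos h2]
      _ ≤ ∑' i : ℕ, (if 2 ^ i * s < x then 2 ^ (i + 1) * s else 0) :=
          ENNReal.le_tsum (f := fun i : ℕ => if 2 ^ i * s < x then 2 ^ (i + 1) * s else 0) m
      _ ≤ _ := le_add_self

/-- The constant in the comparison of weak `L^p` quasi-norms with the associated norm. -/
noncomputable def weakConst (p : ℝ) : ℝ≥0∞ := 1 + 2 * (1 - 2 ^ (1 - p))⁻¹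

theorem weakConst_ne_top (hp : 1 < p) : weakConst p ≠ ∞ := by
  have h : (2 : ℝ≥0∞) ^ (1 - p) < 1 := ENNReal.rpow_lt_one_of_one_lt_of_neg (by norm_num) (by linarith)
  refine ENNReal.add_ne_top.2 ⟨by simp, ENNReal.mul_ne_top (by simp) ?_⟩
  rw [Ne, ENNReal.inv_eq_top]
  exact (tsub_pos_of_lt h).ne'

/-- Weak type bounds control integrals over arbitrary sets. -/
theorem setLIntegral_le_of_weak [IsFiniteMeasure μ] (hp : 1 < p) {G : Ω → ℝ≥0∞}
    (hG : AEMeasurable G μ) {N : ℝ≥0∞} (hN : N ≠ ∞)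
    (hw : ∀ s : ℝ≥0∞, s ≠ 0 → s ≠ ∞ → μ {ω | s < G ω} ≤ (N / s) ^ p) (A : Set Ω) :
    ∫⁻ ω in A, G ω ∂μ ≤ weakConst p * N * μ A ^ (1 - 1 / p) := by
  have hp0 : 0 < p := by linarith
  have key : ∀ s : ℝ≥0∞, s ≠ 0 → s ≠ ∞ →
      ∫⁻ ω in A, G ω ∂μ ≤ s * μ A + 2 * (1 - 2 ^ (1 - p))⁻¹ * (s * (N / s) ^ p) := by
    intro s hs hs'
    have hn : ∀ i : ℕ, NullMeasurableSet {ω | 2 ^ i * s < G ω} (μ.restrict A) :=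
      fun i => nullMeasurableSet_lt aemeasurable_const hG.restrict
    calc ∫⁻ ω in A, G ω ∂μ
        ≤ ∫⁻ ω in A, (s + ∑' i : ℕ,
            {x | 2 ^ i * s < G x}.indicator (fun _ => 2 ^ (i + 1) * s) ω) ∂μ := by
          refine lintegral_mono fun ω => (le_add_tsum_dyadic (G ω) hs hs').trans ?_
          simp only [Set.indicator_apply, Set.mem_ofPred_eq, le_refl]
      _ = s * μ A + ∑' i : ℕ, 2 ^ (i + 1) * s * μ.restrict A {ω | 2 ^ i * s < G ω} := by
          rw [lintegral_add_left measurable_const, lintegral_tsum]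
          · congr 1
            · simp
            · congr 1 with i
              rw [lintegral_indicator_const₀ (hn i)]
          · exact fun i => aemeasurable_const.indicator₀ (hn i)
      -- The level `2^i * s` gains `2^i` from its height and loses `2^(-i*p)` from its tail, so `p >
      -- 1` gives a convergent geometric series.
      _ ≤ s * μ A + ∑' i : ℕ, 2 * (s * (N / s) ^ p) * (2 ^ (1 - p)) ^ i := by
          gcongr _ + ?_
          refine ENNReal.tsum_le_tsum fun i => ?_
          have h2 : (2 : ℝ≥0∞) ^ i ≠ 0 := by simp
          have h2' : (2 : ℝ≥0∞) ^ i ≠ ∞ := by simp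
          calc 2 ^ (i + 1) * s * μ.restrict A {ω | 2 ^ i * s < G ω}
              ≤ 2 ^ (i + 1) * s * (N / (2 ^ i * s)) ^ p := by
                gcongr
                exact (Measure.restrict_apply_le _ _).trans
                  (hw _ (mul_ne_zero h2 hs) (ENNReal.mul_ne_top h2' hs'))
            _ = 2 ^ (i + 1) * s * ((N / s) ^ p * ((2 ^ i)⁻¹) ^ p) := by
                rw [← ENNReal.mul_rpow_of_nonneg _ _ hp0.le, div_eq_mul_inv,
                  ENNReal.mul_inv (Or.inl h2) (Or.inl h2'), div_eq_mul_inv, mul_assoc N,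
                  mul_comm s⁻¹]
            _ = 2 * (s * (N / s) ^ p) * (2 ^ i * ((2 ^ i)⁻¹) ^ p) := by ring
            _ = _ := by
                congr 1
                rw [ENNReal.inv_rpow, ← ENNReal.rpow_neg, ← ENNReal.rpow_natCast,
                  ← ENNReal.rpow_natCast, ← ENNReal.rpow_mul, ← ENNReal.rpow_mul,
                  ← ENNReal.rpow_add _ _ (by simp) (by simp)]
                ring_nf
      _ = _ := by rw [ENNReal.tsum_mul_left, ENNReal.tsum_geometric]; ring
  have hK : 2 * (1 - (2 : ℝ≥0∞) ^ (1 - p))⁻¹ ≠ ∞ := by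
    intro h
    exact weakConst_ne_top hp (by rw [weakConst, h]; simp)
  rcases eq_or_ne (μ A) 0 with hA | hA
  · rw [Measure.restrict_eq_zero.2 hA]; simp
  have hA' : μ A ≠ ∞ := measure_ne_top _ _
  rcases eq_or_ne N 0 with rfl | hN0
  -- The balancing level used below degenerates to `0` when `N = 0`, so arbitrarily small positive
  -- levels are used instead.
  · rw [mul_zero, zero_mul]
    refine ENNReal.le_of_forall_pos_le_add fun ε hε _ => ?_
    have hε0 : (ε : ℝ≥0∞) ≠ 0 := by exact_mod_cast hε.ne'
    have := key (ε / μ A) (ENNReal.div_pos hε0 hA').ne' (ENNReal.div_lt_top (by simp) hA).ne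
    rw [ENNReal.div_mul_cancel hA hA'] at this
    simpa [ENNReal.zero_rpow_of_pos hp0] using this
  -- This level balances the two terms of `key`: it makes `(N / s)^p = μ A`.
  · set s : ℝ≥0∞ := N * μ A ^ (-(1 / p)) with hs
    have hm0 : μ A ^ (-(1 / p)) ≠ 0 := by
      simp [ENNReal.rpow_eq_zero_iff, hA, hA']
    have hm1 : μ A ^ (-(1 / p)) ≠ ∞ := ENNReal.rpow_ne_top_of_ne_zero hA hA'
    have hs0 : s ≠ 0 := mul_ne_zero hN0 hm0
    have hs1 : s ≠ ∞ := ENNReal.mul_ne_top hN hm1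
    have e1 : (N / s) ^ p = μ A := by
      have : N / s = μ A ^ (1 / p) := by
        rw [hs, div_eq_mul_inv, ENNReal.mul_inv (Or.inl hN0) (Or.inl hN), ← mul_assoc,
          ENNReal.mul_inv_cancel hN0 hN, one_mul, ENNReal.rpow_neg, inv_inv]
      rw [this, ← ENNReal.rpow_mul, one_div_mul_cancel hp0.ne', ENNReal.rpow_one]
    have e2 : s * μ A = N * μ A ^ (1 - 1 / p) := by
      rw [hs, mul_assoc, sub_eq_neg_add, ENNReal.rpow_add _ _ hA hA', ENNReal.rpow_one]
    have := key s hs0 hs1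
    rw [e1, e2] at this
    refine this.trans_eq ?_
    rw [weakConst]; ring

/-- Control of the integrals over all sets gives back a weak type bound. -/
theorem weak_of_setLIntegral_le [IsFiniteMeasure μ] (hp : 1 < p) {X : Ω → ℝ≥0∞}
    (hX : AEMeasurable X μ) {D : ℝ≥0∞}
    (hD : ∀ A : Set Ω, ∫⁻ ω in A, X ω ∂μ ≤ D * μ A ^ (1 - 1 / p)) (t : ℝ≥0∞) :
    t ^ p * μ {ω | t ≤ X ω} ≤ D ^ p := by
  have hp0 : 0 < p := by linarith
  set A := {ω | t ≤ X ω} with hA_def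
  rcases eq_or_ne (μ A) 0 with hA | hA
  · simp [hA]
  have hA' : μ A ≠ ∞ := measure_ne_top _ _
  -- Markov's inequality on the level set itself; dividing by `μ A ^ (1 - 1/p)` leaves the weak
  -- bound.
  have h1 : t * μ A ≤ D * μ A ^ (1 - 1 / p) := by
    have := mul_meas_ge_le_lintegral₀ (μ := μ.restrict A) hX.restrict t
    rw [← hA_def, Measure.restrict_apply_self] at this
    exact this.trans (hD A)
  have hm0 : μ A ^ (1 - 1 / p) ≠ 0 := by simp [ENNReal.rpow_eq_zero_iff, hA, hA']
  have hm1 : μ A ^ (1 - 1 / p) ≠ ∞ := ENNReal.rpow_ne_top_of_ne_zero hA hA'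
  have h2 : t * μ A ^ (1 / p) ≤ D := by
    have e : μ A = μ A ^ (1 / p) * μ A ^ (1 - 1 / p) := by
      rw [← ENNReal.rpow_add _ _ hA hA']; simp
    rw [e, ← mul_assoc, ← e] at h1
    exact (ENNReal.mul_le_mul_iff_left hm0 hm1).1 h1
  calc t ^ p * μ A = (t * μ A ^ (1 / p)) ^ p := by
        rw [ENNReal.mul_rpow_of_nonneg _ _ hp0.le, ← ENNReal.rpow_mul,
          one_div_mul_cancel hp0.ne', ENNReal.rpow_one]
    _ ≤ D ^ p := by gcongr

end Weak

/-! ### Binary chaining and reduction of the series to powers of two. -/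

section Dyadic

/-- Removing the lowest binary digits of `n` one at a time. -/
theorem two_pow_mul_div_eq (n k : ℕ) :
    2 ^ k * (n / 2 ^ k) = 2 ^ (k + 1) * (n / 2 ^ (k + 1)) + (if n.testBit k then 2 ^ k else 0) := by
  have h : n / 2 ^ (k + 1) = n / 2 ^ k / 2 := by rw [pow_succ, Nat.div_div_eq_div_mul]
  rw [h, pow_succ]
  have h2 := Nat.div_add_mod (n / 2 ^ k) 2
  rw [Nat.testBit_eq_decide_div_mod_eq]
  generalize n / 2 ^ k = m at *
  rcases Nat.mod_two_eq_zero_or_one m with h0 | h0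
  · simp only [h0, zero_ne_one, decide_false, Bool.false_eq_true, if_false, add_zero]
    rw [mul_assoc]; congr 1; omega
  · simp only [h0, decide_true, if_true]
    rw [mul_assoc, ← mul_add_one]; congr 1; omega

theorem chain_decomposition {E : Type*} [AddCommGroup E] {v : ℕ → E} {w : ℕ → ℕ → E}
    (hadd : ∀ n m, v (n + m) = v n + w n m) (n K : ℕ) :
    v n = v (2 ^ K * (n / 2 ^ K)) + ∑ k ∈ Finset.range K,
      (if n.testBit k then w (2 ^ (k + 1) * (n / 2 ^ (k + 1))) (2 ^ k) else 0) := by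
  induction K with
  | zero => simp
  | succ K ih =>
    rw [Finset.sum_range_succ, ih, two_pow_mul_div_eq n K]
    split_ifs
    · rw [hadd]; abel
    · simp

theorem norm_le_chain {E : Type*} [NormedAddCommGroup E] {v : ℕ → E} {w : ℕ → ℕ → E}
    (h0 : v 0 = 0) (hadd : ∀ n m, v (n + m) = v n + w n m) (n : ℕ) :
    ‖v n‖ ≤ ∑ k ∈ Finset.range n,
      (if n.testBit k then ‖w (2 ^ (k + 1) * (n / 2 ^ (k + 1))) (2 ^ k)‖ else 0) := by
  -- Since `n < 2^n`, stripping `n` digits leaves nothing.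
  rw [chain_decomposition hadd n n, Nat.div_eq_of_lt Nat.lt_two_pow_self, mul_zero, h0, zero_add]
  refine (norm_sum_le _ _).trans (Finset.sum_le_sum fun k _ => ?_)
  split_ifs <;> simp

/-- This lets `n^(1/p)` dominate the product of the block-length weight `2^(k/p)` and the position
weight `(j + 1)^(1/p)`, with `j = n / 2^(k+1)`. -/
theorem le_of_testBit {n k : ℕ} (h : n.testBit k) : 2 ^ k * (n / 2 ^ (k + 1) + 1) ≤ n := by
  have h1 := two_pow_mul_div_eq n k
  rw [if_pos h] at h1
  have h2 := Nat.mul_div_le n (2 ^ k)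
  calc 2 ^ k * (n / 2 ^ (k + 1) + 1) ≤ 2 ^ (k + 1) * (n / 2 ^ (k + 1)) + 2 ^ k := by
        rw [mul_add_one]; gcongr <;> omega
    _ ≤ n := by omega

/-- An almost subadditive sequence is controlled by its averages. -/
theorem natCast_mul_le_sum {a : ℕ → ℝ≥0∞} {K : ℝ≥0∞} (h0 : a 0 = 0)
    (hadd : ∀ n m, a (n + m) ≤ a n + K * a m) (N : ℕ) :
    N * a N ≤ (1 + K) * ∑ n ∈ Finset.range N, a (n + 1) := by
  calc N * a N = ∑ n ∈ Finset.range N, a N := by simp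
    -- `N` is split as `(n + 1) + (N - 1 - n)` in every possible way; reflection turns the second
    -- family into `a 0, …, a (N - 1)`.
    _ ≤ ∑ n ∈ Finset.range N, (a (n + 1) + K * a (N - 1 - n)) := by
        refine Finset.sum_le_sum fun n hn => ?_
        rw [Finset.mem_range] at hn
        have := hadd (n + 1) (N - 1 - n)
        rwa [show n + 1 + (N - 1 - n) = N by omega] at this
    _ = ∑ n ∈ Finset.range N, a (n + 1) + K * ∑ n ∈ Finset.range N, a n := by
        rw [Finset.sum_add_distrib, Finset.mul_sum, ← Finset.sum_range_reflect (fun n => K * a n)]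
    _ ≤ ∑ n ∈ Finset.range N, a (n + 1) + K * ∑ n ∈ Finset.range N, a (n + 1) := by
        gcongr _ + K * ?_
        cases N with
        | zero => simp
        | succ N =>
          rw [Finset.sum_range_succ', h0, add_zero, Finset.sum_range_succ]
          exact le_self_add
    _ = _ := by ring

/-- Each `a (2^k)` is bounded by an average of `a` over `[1, 2^k]`. After exchanging the sums, the
factor `2` bounds the geometric sum of `(n + 1) / 2^k` over `2^k ≥ n + 1`. -/
theorem tsum_two_pow_le {p : ℝ} (hp : 1 < p) {ψ : ℝ → ℝ}
    (hψ_pos : ∀ x, 1 ≤ x → 0 < ψ x) (hψ_mono : MonotoneOn ψ (Set.Ici 1))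
    {a : ℕ → ℝ≥0∞} {K : ℝ≥0∞} (h0 : a 0 = 0) (hadd : ∀ n m, a (n + m) ≤ a n + K * a m) :
    ∑' k : ℕ, a (2 ^ k) / ENNReal.ofReal (ψ (2 ^ k) * (2 ^ k) ^ (1 / p))
      ≤ (1 + K) * 2 * ∑' n : ℕ, a (n + 1) /
        ENNReal.ofReal (ψ ((n + 1 : ℕ) : ℝ) * ((n + 1 : ℕ) : ℝ) ^ (1 + 1 / p)) := by
  have hp0 : 0 < p := by linarith
  have hc : ∀ n k : ℕ, n + 1 ≤ 2 ^ k →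
      (ENNReal.ofReal (ψ (2 ^ k) * (2 ^ k) ^ (1 / p)))⁻¹ * (2 ^ k : ℝ≥0∞)⁻¹ ≤
      (ENNReal.ofReal (ψ ((n + 1 : ℕ) : ℝ) * ((n + 1 : ℕ) : ℝ) ^ (1 + 1 / p)))⁻¹ *
        (((n + 1 : ℕ) : ℝ≥0∞) / 2 ^ k) := by
    intro n k hnk
    have hn1 : (1 : ℝ) ≤ ((n + 1 : ℕ) : ℝ) := by exact_mod_cast Nat.succ_pos n
    have hnk' : ((n + 1 : ℕ) : ℝ) ≤ 2 ^ k := by exact_mod_cast hnk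
    have hψ1 := hψ_pos _ hn1
    rw [div_eq_mul_inv ((n + 1 : ℕ) : ℝ≥0∞), ← mul_assoc]
    gcongr ?_ * _
    have hle : ψ ((n + 1 : ℕ) : ℝ) * ((n + 1 : ℕ) : ℝ) ^ (1 / p) ≤ ψ (2 ^ k) * (2 ^ k) ^ (1 / p) := by
      gcongr
      · exact (hψ1.trans_le (hψ_mono hn1 (hn1.trans hnk') hnk')).le
      · exact hψ_mono hn1 (hn1.trans hnk') hnk'
    calc (ENNReal.ofReal (ψ (2 ^ k) * (2 ^ k) ^ (1 / p)))⁻¹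
        ≤ (ENNReal.ofReal (ψ ((n + 1 : ℕ) : ℝ) * ((n + 1 : ℕ) : ℝ) ^ (1 / p)))⁻¹ :=
          ENNReal.inv_le_inv.2 (ENNReal.ofReal_le_ofReal hle)
      _ = _ := by
          have hx : 0 < ((n + 1 : ℕ) : ℝ) := by linarith
          rw [Real.rpow_add hx, Real.rpow_one, ← ENNReal.ofReal_natCast (n + 1),
            ← ENNReal.ofReal_inv_of_pos (by positivity), ← ENNReal.ofReal_inv_of_pos (by positivity),
            ← ENNReal.ofReal_mul (by positivity)]
          congr 1
          field_simp
  have hg : ∀ n : ℕ, ∑' k : ℕ, (if n + 1 ≤ 2 ^ k then ((n + 1 : ℕ) : ℝ≥0∞) / 2 ^ k else 0) ≤ 2 := by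
    intro n
    have hcl : ∀ k, n + 1 ≤ 2 ^ k ↔ Nat.clog 2 (n + 1) ≤ k :=
      fun k => (Nat.clog_le_iff_le_pow (by norm_num)).symm
    rw [← Summable.sum_add_tsum_nat_add' (k := Nat.clog 2 (n + 1)) ENNReal.summable, Finset.sum_eq_zero, zero_add]
    · calc _ ≤ ∑' i : ℕ, (2⁻¹ : ℝ≥0∞) ^ i := by
            refine ENNReal.tsum_le_tsum fun i => ?_
            rw [if_pos ((hcl _).2 (by omega))]
            refine ENNReal.div_le_of_le_mul ?_
            rw [pow_add, ← mul_assoc, ← ENNReal.inv_pow, ENNReal.inv_mul_cancel (by simp) (by simp),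
              one_mul]
            exact_mod_cast (hcl _).2 le_rfl
        _ = 2 := by rw [ENNReal.tsum_geometric, ENNReal.one_sub_inv_two, inv_inv]
    · intro k hk
      rw [Finset.mem_range] at hk
      rw [if_neg (by rw [hcl]; omega)]
  calc ∑' k : ℕ, a (2 ^ k) / ENNReal.ofReal (ψ (2 ^ k) * (2 ^ k) ^ (1 / p))
      ≤ ∑' k : ℕ, (1 + K) * ∑' n : ℕ, (a (n + 1) /
        ENNReal.ofReal (ψ ((n + 1 : ℕ) : ℝ) * ((n + 1 : ℕ) : ℝ) ^ (1 + 1 / p)) *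
        (if n + 1 ≤ 2 ^ k then ((n + 1 : ℕ) : ℝ≥0∞) / 2 ^ k else 0)) := by
        refine ENNReal.tsum_le_tsum fun k => ?_
        have h1 := natCast_mul_le_sum h0 hadd (2 ^ k)
        have h2 : a (2 ^ k) ≤ (2 ^ k : ℝ≥0∞)⁻¹ * ((1 + K) * ∑ n ∈ Finset.range (2 ^ k), a (n + 1)) := by
          rw [← ENNReal.mul_le_iff_le_inv (by simp) (by simp)]
          exact_mod_cast h1
        calc _ ≤ (2 ^ k : ℝ≥0∞)⁻¹ * ((1 + K) * ∑ n ∈ Finset.range (2 ^ k), a (n + 1)) /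
              ENNReal.ofReal (ψ (2 ^ k) * (2 ^ k) ^ (1 / p)) := by gcongr
          _ = (1 + K) * ∑ n ∈ Finset.range (2 ^ k), a (n + 1) *
              ((ENNReal.ofReal (ψ (2 ^ k) * (2 ^ k) ^ (1 / p)))⁻¹ * (2 ^ k : ℝ≥0∞)⁻¹) := by
              rw [← Finset.sum_mul, div_eq_mul_inv]; ring
          _ ≤ (1 + K) * ∑ n ∈ Finset.range (2 ^ k), (a (n + 1) /
              ENNReal.ofReal (ψ ((n + 1 : ℕ) : ℝ) * ((n + 1 : ℕ) : ℝ) ^ (1 + 1 / p)) *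
              (if n + 1 ≤ 2 ^ k then ((n + 1 : ℕ) : ℝ≥0∞) / 2 ^ k else 0)) := by
              gcongr (1 + K) * ?_
              refine Finset.sum_le_sum fun n hn => ?_
              rw [Finset.mem_range] at hn
              rw [if_pos (by omega), div_eq_mul_inv (a (n + 1)), mul_assoc]
              gcongr a (n + 1) * ?_
              exact hc n k (by omega)
          _ ≤ _ := by gcongr; exact ENNReal.sum_le_tsum _
    _ = (1 + K) * ∑' n : ℕ, (a (n + 1) /
        ENNReal.ofReal (ψ ((n + 1 : ℕ) : ℝ) * ((n + 1 : ℕ) : ℝ) ^ (1 + 1 / p)) *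
        ∑' k : ℕ, (if n + 1 ≤ 2 ^ k then ((n + 1 : ℕ) : ℝ≥0∞) / 2 ^ k else 0)) := by
        rw [ENNReal.tsum_mul_left, ENNReal.tsum_comm]
        simp only [ENNReal.tsum_mul_left]
    _ ≤ (1 + K) * ∑' n : ℕ, (a (n + 1) /
        ENNReal.ofReal (ψ ((n + 1 : ℕ) : ℝ) * ((n + 1 : ℕ) : ℝ) ^ (1 + 1 / p)) * 2) := by
        gcongr with n; exact hg n
    _ = _ := by rw [ENNReal.tsum_mul_right]; ring

end Dyadic

/-! ### Maximal inequality and almost sure convergence along the blocks. -/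

section Maximal

variable {μ : Measure Ω} {p : ℝ}

/-- Weak type maximal inequality for a sequence of tail dominated functions. -/
theorem TailDominated.measure_lt_iSup_le (hp : 1 < p) {h : ℕ → Ω → ℝ≥0∞} {g : Ω → ℝ≥0∞}
    (hg : AEMeasurable g μ) (hD : ∀ j, TailDominated μ (h j) g) {s : ℝ≥0∞} (hs : s ≠ 0)
    (hs' : s ≠ ∞) :
    μ {ω | s < ⨆ j : ℕ, h j ω / ((j : ℝ≥0∞) + 1) ^ (1 / p)} ≤
      (2 * ENNReal.ofReal (p / (p - 1)) ^ (1 / p) * (∫⁻ ω, g ω ^ p ∂μ) ^ (1 / p) / s) ^ p := by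
  have hp0 : 0 < p := by linarith
  have h2 : 2 * (s / 2) = s := ENNReal.mul_div_cancel (by simp) (by simp)
  have hs2 : s / 2 ≠ 0 := (ENNReal.div_pos hs (by simp)).ne'
  have hs2' : s / 2 ≠ ∞ := (ENNReal.div_lt_top hs' (by simp)).ne
  calc _ ≤ μ (⋃ j : ℕ, {ω | 2 * (s / 2 * ((j : ℝ≥0∞) + 1) ^ (1 / p)) ≤ h j ω}) := by
        refine measure_mono fun ω hω => ?_
        rw [Set.mem_ofPred_eq, lt_iSup_iff] at hω
        obtain ⟨j, hj⟩ := hω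
        refine Set.mem_iUnion.2 ⟨j, ?_⟩
        rw [ENNReal.lt_div_iff_mul_lt (Or.inl (succ_rpow_ne_zero j _))
          (Or.inl (succ_rpow_ne_top j _))] at hj
        change 2 * (s / 2 * ((j : ℝ≥0∞) + 1) ^ (1 / p)) ≤ h j ω
        rw [← mul_assoc, h2]
        exact hj.le
    _ ≤ ∑' j : ℕ, μ {ω | 2 * (s / 2 * ((j : ℝ≥0∞) + 1) ^ (1 / p)) ≤ h j ω} := measure_iUnion_le _
    _ ≤ ENNReal.ofReal (p / (p - 1)) * ∫⁻ ω, (g ω / (s / 2)) ^ p ∂μ :=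
        TailDominated.tsum_measure_le hp hg hD hs2 hs2'
    _ = ENNReal.ofReal (p / (p - 1)) * ((∫⁻ ω, g ω ^ p ∂μ) * ((s / 2)⁻¹) ^ p) := by
        rw [← lintegral_mul_const'' _ (hg.pow_const _)]
        congr 1
        refine lintegral_congr fun ω => ?_
        rw [div_eq_mul_inv (g ω), ENNReal.mul_rpow_of_nonneg _ _ hp0.le]
    _ = _ := by
        have hr : ∀ x : ℝ≥0∞, (x ^ (1 / p)) ^ p = x := fun x => by
          rw [← ENNReal.rpow_mul, one_div_mul_cancel hp0.ne', ENNReal.rpow_one]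
        rw [ENNReal.inv_div (by simp) (by simp)]
        simp only [div_eq_mul_inv _ s]
        rw [ENNReal.mul_rpow_of_nonneg _ _ hp0.le, ENNReal.mul_rpow_of_nonneg _ _ hp0.le,
          ENNReal.mul_rpow_of_nonneg _ _ hp0.le, ENNReal.mul_rpow_of_nonneg _ _ hp0.le, hr, hr]
        ring

/-- Borel–Cantelli at each level `1 / (i + 1)`: the summed tail bound is finite since `g` has a
finite `p`-th moment. -/
theorem TailDominated.ae_tendsto_zero (hp : 1 < p) {h : ℕ → Ω → ℝ≥0∞} {g : Ω → ℝ≥0∞}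
    (hg : AEMeasurable g μ) (hD : ∀ j, TailDominated μ (h j) g)
    (hfin : ∫⁻ ω, g ω ^ p ∂μ ≠ ∞) :
    ∀ᵐ ω ∂μ, Tendsto (fun j : ℕ => h j ω / ((j : ℝ≥0∞) + 1) ^ (1 / p)) atTop (𝓝 0) := by
  have hp0 : 0 < p := by linarith
  have key : ∀ i : ℕ, ∀ᵐ ω ∂μ, ∀ᶠ j : ℕ in atTop,
      ω ∉ {ω | 2 * (((i : ℝ≥0∞) + 1)⁻¹ * ((j : ℝ≥0∞) + 1) ^ (1 / p)) ≤ h j ω} := by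
    intro i
    refine ae_eventually_notMem (ne_top_of_le_ne_top ?_
      (TailDominated.tsum_measure_le hp hg hD (t := ((i : ℝ≥0∞) + 1)⁻¹) (by simp) (by simp)))
    refine ENNReal.mul_ne_top (by simp) ?_
    have : ∀ ω, (g ω / ((i : ℝ≥0∞) + 1)⁻¹) ^ p = g ω ^ p * ((i : ℝ≥0∞) + 1) ^ p := fun ω => by
      rw [div_eq_mul_inv, inv_inv, ENNReal.mul_rpow_of_nonneg _ _ hp0.le]
    simp only [this]
    rw [lintegral_mul_const'' _ (hg.pow_const _)]
    exact ENNReal.mul_ne_top hfin (succ_rpow_ne_top i p)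
  filter_upwards [ae_all_iff.2 key] with ω hω
  rw [ENNReal.tendsto_nhds_zero]
  intro ε hε
  obtain ⟨i, hi⟩ := ENNReal.exists_inv_nat_lt (ENNReal.div_pos hε.ne' (show (2 : ℝ≥0∞) ≠ ∞ by simp)).ne'
  filter_upwards [hω i] with j hj
  rw [ENNReal.div_le_iff (succ_rpow_ne_zero j _) (succ_rpow_ne_top j _)]
  have hj' : h j ω < 2 * (((i : ℝ≥0∞) + 1)⁻¹ * ((j : ℝ≥0∞) + 1) ^ (1 / p)) := not_le.1 hj
  refine hj'.le.trans ?_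
  rw [← mul_assoc]
  gcongr
  calc 2 * ((i : ℝ≥0∞) + 1)⁻¹ ≤ 2 * (ε / 2) := by
        gcongr
        exact (ENNReal.inv_le_inv.2 le_self_add).trans hi.le
    _ = ε := ENNReal.mul_div_cancel (by simp) (by simp)

end Maximal

/-! ### From block bounds to the growth rate. -/

section Rate

/-- The normalised shifted dyadic blocks occurring in the chaining argument. -/
noncomputable def blockQuotient {E : Type*} [NormedAddCommGroup E] (p : ℝ) (w : ℕ → ℕ → E)
    (k j : ℕ) : ℝ≥0∞ :=
  ‖w (2 ^ (k + 1) * j) (2 ^ k)‖ₑ / ((j : ℝ≥0∞) + 1) ^ (1 / p)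

/-- The maximal function dominating all rate quotients. -/
noncomputable def chainBound {E : Type*} [NormedAddCommGroup E] (p : ℝ) (ψ : ℝ → ℝ)
    (w : ℕ → ℕ → E) : ℝ≥0∞ :=
  ∑' k : ℕ, (ENNReal.ofReal (ψ (2 ^ k) * (2 ^ k) ^ (1 / p)))⁻¹ * ⨆ j, blockQuotient p w k j

/-- The deterministic core, applied at almost every `ω`. Finiteness of `chainBound` supplies both
the uniform bound and the summable majorant for dominated convergence. -/
theorem chain_rate {E : Type*} [NormedAddCommGroup E] {p : ℝ} (hp : 1 < p) {ψ : ℝ → ℝ}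
    (hψ_pos : ∀ x, 1 ≤ x → 0 < ψ x) (hψ_mono : MonotoneOn ψ (Set.Ici 1))
    {v : ℕ → E} {w : ℕ → ℕ → E} (h0 : v 0 = 0) (hadd : ∀ n m, v (n + m) = v n + w n m)
    (hX : chainBound p ψ w ≠ ∞) (hw : ∀ k, Tendsto (blockQuotient p w k) atTop (𝓝 0)) :
    (∀ n : ℕ, 1 ≤ n → ‖v n‖ / (ψ n * (n : ℝ) ^ (1 / p)) ≤ (chainBound p ψ w).toReal) ∧
      Tendsto (fun n : ℕ => ‖v n‖ / (ψ n * (n : ℝ) ^ (1 / p))) atTop (𝓝 0) := by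
  have hp0 : 0 < p := by linarith
  have h2k : ∀ k : ℕ, (1 : ℝ) ≤ 2 ^ k := fun k => one_le_pow₀ (by norm_num)
  set c : ℕ → ℝ≥0∞ := fun k => (ENNReal.ofReal (ψ (2 ^ k) * (2 ^ k) ^ (1 / p)))⁻¹ with hc
  have hcpos : ∀ k : ℕ, 0 < ψ (2 ^ k) * ((2 : ℝ) ^ k) ^ (1 / p) :=
    fun k => mul_pos (hψ_pos _ (h2k k)) (by positivity)
  have hc_top : ∀ k, c k ≠ ∞ := fun k => by
    simpa only [hc, Ne, ENNReal.inv_eq_top, ENNReal.ofReal_eq_zero, not_le] using hcpos k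
  have hterm : ∀ k, c k * ⨆ j, blockQuotient p w k j ≠ ∞ := ENNReal.ne_top_of_tsum_ne_top hX
  set a : ℕ → ℕ → ℝ := fun n k =>
    if n.testBit k then (c k * blockQuotient p w k (n / 2 ^ (k + 1))).toReal else 0 with ha
  have hbound : ∀ n k, ‖a n k‖ ≤ (c k * ⨆ j, blockQuotient p w k j).toReal := by
    intro n k
    simp only [ha]
    split_ifs
    · rw [Real.norm_of_nonneg ENNReal.toReal_nonneg]
      refine ENNReal.toReal_mono (hterm k) ?_
      gcongr
      exact le_iSup (blockQuotient p w k) _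
    · rw [norm_zero]; exact ENNReal.toReal_nonneg
  have ha0 : ∀ n k, 0 ≤ a n k := by
    intro n k; simp only [ha]; split_ifs
    · exact ENNReal.toReal_nonneg
    · exact le_rfl
  have hsumm : Summable fun k => (c k * ⨆ j, blockQuotient p w k j).toReal :=
    ENNReal.summable_toReal hX
  have hsumm_a : ∀ n, Summable (a n) := fun n => Summable.of_norm_bounded hsumm (hbound n)
  have hle : ∀ n : ℕ, 1 ≤ n → ‖v n‖ / (ψ n * (n : ℝ) ^ (1 / p)) ≤ ∑' k, a n k := by
    intro n hn
    have hn1 : (1 : ℝ) ≤ n := by exact_mod_cast hn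
    have hψn := hψ_pos n hn1
    refine le_trans ?_ ((hsumm_a n).sum_le_tsum (Finset.range n) fun k _ => ha0 n k)
    refine (div_le_div_of_nonneg_right (norm_le_chain h0 hadd n) (by positivity)).trans ?_
    rw [Finset.sum_div]
    refine Finset.sum_le_sum fun k _ => ?_
    simp only [ha]
    split_ifs with hk
    · have hkn := le_of_testBit hk
      set j := n / 2 ^ (k + 1)
      have hkn' : (2 : ℝ) ^ k * ((j : ℝ) + 1) ≤ n := by exact_mod_cast hkn
      have h2kn : (2 : ℝ) ^ k ≤ n := by
        refine le_trans ?_ hkn'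
        exact le_mul_of_one_le_right (by positivity) (by linarith [j.cast_nonneg (α := ℝ)])
      have hψk := hψ_pos _ (h2k k)
      have e : (c k * blockQuotient p w k j).toReal =
          ‖w (2 ^ (k + 1) * j) (2 ^ k)‖ / (ψ (2 ^ k) * ((2 : ℝ) ^ k * ((j : ℝ) + 1)) ^ (1 / p)) := by
        rw [blockQuotient, ofReal_succ_rpow j (by positivity), ENNReal.toReal_mul,
          ENNReal.toReal_div, toReal_enorm, ENNReal.toReal_ofReal (by positivity)]
        simp only [hc]
        rw [ENNReal.toReal_inv, ENNReal.toReal_ofReal (hcpos k).le,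
          Real.mul_rpow (by positivity) (by positivity)]
        field_simp
      rw [e]
      gcongr
      exact hψ_mono (h2k k) hn1 h2kn
    · simp
  refine ⟨fun n hn => (hle n hn).trans ?_, ?_⟩
  · rw [chainBound, ENNReal.tsum_toReal_eq hterm]
    exact (hsumm_a n).tsum_le_tsum (fun k => (le_abs_self _).trans (hbound n k)) hsumm
  · have ht : Tendsto (fun n => ∑' k, a n k) atTop (𝓝 (∑' _ : ℕ, (0 : ℝ))) := by
      refine tendsto_tsum_of_dominated_convergence hsumm (fun k => ?_)
        (Eventually.of_forall hbound)
      -- For fixed `k` the block position `n / 2^(k+1)` tends to infinity with `n`.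
      have h1 : Tendsto (fun n : ℕ => (c k * blockQuotient p w k (n / 2 ^ (k + 1))).toReal)
          atTop (𝓝 0) := by
        have h2 := ((hw k).comp (Nat.tendsto_div_const_atTop (n := 2 ^ (k + 1)) (by positivity)))
        have h3 := ENNReal.Tendsto.const_mul (a := c k) h2 (Or.inr (hc_top k))
        rw [mul_zero] at h3
        exact (ENNReal.tendsto_toReal (by simp)).comp h3
      refine squeeze_zero (fun n => ha0 n k) (fun n => ?_) h1
      simp only [ha]
      split_ifs
      · exact le_rfl
      · exact ENNReal.toReal_nonneg
    rw [tsum_zero] at ht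
    refine squeeze_zero' ?_ ?_ ht
    · filter_upwards [eventually_ge_atTop 1] with n hn
      have := hψ_pos n (by exact_mod_cast hn)
      positivity
    · filter_upwards [eventually_ge_atTop 1] with n hn
      exact hle n hn

/-- The rate of growth for an additive cocycle whose shifted blocks are tail dominated. -/
theorem rate_of_tailDominated {E : Type*} [NormedAddCommGroup E] {μ : Measure Ω}
    [IsProbabilityMeasure μ] {p : ℝ} (hp : 1 < p) {ψ : ℝ → ℝ}
    (hψ_pos : ∀ x, 1 ≤ x → 0 < ψ x) (hψ_mono : MonotoneOn ψ (Set.Ici 1))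
    {V : ℕ → Ω → E} {W : ℕ → ℕ → Ω → E} (hV : ∀ n, AEStronglyMeasurable (V n) μ)
    (hW : ∀ n m, AEStronglyMeasurable (W n m) μ) (h0 : V 0 =ᵐ[μ] 0)
    (hadd : ∀ n m, V (n + m) =ᵐ[μ] V n + W n m)
    (hD : ∀ n m, TailDominated μ (fun ω => ‖W n m ω‖ₑ) (fun ω => ‖V m ω‖ₑ))
    (hsum : SummableNorms μ p ψ V) :
    (∀ᵐ ω ∂μ, BddAbove (Set.range fun n : ℕ => rateQuotient p ψ V (n + 1) ω)) ∧
      MemWeakLp μ p (fun ω => ⨆ n : ℕ, rateQuotient p ψ V (n + 1) ω) ∧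
      ∀ᵐ ω ∂μ, Tendsto (fun n : ℕ => rateQuotient p ψ V n ω) atTop (𝓝 0) := by
  have hp0 : 0 < p := by linarith
  have hpe0 : ENNReal.ofReal p ≠ 0 := by simpa using hp0
  have hpe1 : ENNReal.ofReal p ≠ ∞ := by simp
  have hnorm : ∀ u : Ω → E, eLpNorm u (ENNReal.ofReal p) μ = (∫⁻ ω, ‖u ω‖ₑ ^ p ∂μ) ^ (1 / p) := by
    intro u
    rw [eLpNorm_eq_lintegral_rpow_enorm_toReal hpe0 hpe1, ENNReal.toReal_ofReal hp0.le]
  set a : ℕ → ℝ≥0∞ := fun n => eLpNorm (V n) (ENNReal.ofReal p) μ with ha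
  set Q : ℝ≥0∞ := ENNReal.ofReal (p / (p - 1)) with hQ
  set K : ℝ≥0∞ := (Q * 2 ^ p) ^ (1 / p) with hK
  have hK_top : K ≠ ∞ := by
    refine ENNReal.rpow_ne_top_of_nonneg (by positivity) (ENNReal.mul_ne_top (by simp [hQ]) ?_)
    exact ENNReal.rpow_ne_top_of_nonneg hp0.le (by simp)
  have ha0 : a 0 = 0 := by simp only [ha]; rw [eLpNorm_congr_ae h0]; exact eLpNorm_zero
  -- Tail domination yields an `L^p` bound only up to the constant `K`, hence almost subadditivity.
  have ha_add : ∀ n m, a (n + m) ≤ a n + K * a m := by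
    intro n m
    simp only [ha]
    rw [eLpNorm_congr_ae (hadd n m)]
    refine (eLpNorm_add_le (hV n) (hW n m) (by simpa using hp.le)).trans ?_
    gcongr
    rw [hnorm, hnorm, hK, ← ENNReal.mul_rpow_of_nonneg _ _ (by positivity)]
    gcongr
    exact TailDominated.lintegral_rpow_le hp (hW n m).enorm (hV m).enorm (hD n m)
  set b : ℝ≥0∞ := ∑' k : ℕ, a (2 ^ k) / ENNReal.ofReal (ψ (2 ^ k) * (2 ^ k) ^ (1 / p)) with hb
  have hb_top : b ≠ ∞ := by
    refine ne_top_of_le_ne_top ?_ (tsum_two_pow_le hp hψ_pos hψ_mono ha0 ha_add)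
    exact ENNReal.mul_ne_top (ENNReal.mul_ne_top (by simp [hK_top]) (by simp)) hsum.ne
  have ha_top : ∀ k : ℕ, a (2 ^ k) ≠ ∞ := by
    intro k hk
    have := ENNReal.ne_top_of_tsum_ne_top hb_top k
    rw [hk, ENNReal.top_div_of_ne_top (by simp)] at this
    exact this rfl
  have hVp : ∀ k : ℕ, ∫⁻ ω, ‖V (2 ^ k) ω‖ₑ ^ p ∂μ ≠ ∞ := by
    intro k hk
    refine ha_top k ?_
    simp only [ha]
    rw [hnorm, hk, ENNReal.top_rpow_of_pos (by positivity)]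
  set G : ℕ → Ω → ℝ≥0∞ := fun k ω => ⨆ j, blockQuotient p (fun n m => W n m ω) k j with hG
  have hGm : ∀ k, AEMeasurable (G k) μ := fun k =>
    AEMeasurable.iSup fun j => (hW _ _).enorm.div_const _
  set X : Ω → ℝ≥0∞ := fun ω => chainBound p ψ (fun n m => W n m ω) with hX
  have hXm : AEMeasurable X μ := AEMeasurable.tsum fun k => (hGm k).const_mul _
  set D : ℝ≥0∞ := weakConst p * (2 * Q ^ (1 / p)) * b with hD_def
  have hD_top : D ≠ ∞ := by
    refine ENNReal.mul_ne_top (ENNReal.mul_ne_top (weakConst_ne_top hp) ?_) hb_top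
    exact ENNReal.mul_ne_top (by simp) (ENNReal.rpow_ne_top_of_nonneg (by positivity) (by simp [hQ]))
  -- Integrals over a fixed `A` add exactly over `k`, so the weak bounds are summed in this form
  -- without a quasi-norm loss.
  have hXA : ∀ A : Set Ω, ∫⁻ ω in A, X ω ∂μ ≤ D * μ A ^ (1 - 1 / p) := by
    intro A
    calc ∫⁻ ω in A, X ω ∂μ = ∑' k : ℕ, (ENNReal.ofReal (ψ (2 ^ k) * (2 ^ k) ^ (1 / p)))⁻¹ *
          ∫⁻ ω in A, G k ω ∂μ := by
          simp only [hX, chainBound]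
          rw [lintegral_tsum fun k => ((hGm k).const_mul _).restrict]
          congr 1 with k
          exact lintegral_const_mul'' _ (hGm k).restrict
      _ ≤ ∑' k : ℕ, (ENNReal.ofReal (ψ (2 ^ k) * (2 ^ k) ^ (1 / p)))⁻¹ *
          (weakConst p * (2 * Q ^ (1 / p) * a (2 ^ k)) * μ A ^ (1 - 1 / p)) := by
          gcongr with k
          refine setLIntegral_le_of_weak hp (hGm k) ?_ (fun s hs hs' => ?_) A
          · exact ENNReal.mul_ne_top (ENNReal.mul_ne_top (by simp)
              (ENNReal.rpow_ne_top_of_nonneg (by positivity) (by simp [hQ]))) (ha_top k)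
          · have := TailDominated.measure_lt_iSup_le hp (hV (2 ^ k)).enorm
              (fun j => hD (2 ^ (k + 1) * j) (2 ^ k)) hs hs'
            simp only [ha, hnorm]
            exact this
      _ = _ := by
          rw [hD_def, hb, ← ENNReal.tsum_mul_left, ← ENNReal.tsum_mul_right]
          congr 1 with k
          rw [div_eq_mul_inv (a (2 ^ k))]; ring
  have hXint : ∫⁻ ω, X ω ∂μ ≠ ∞ := by
    have := hXA Set.univ
    rw [setLIntegral_univ, measure_univ, ENNReal.one_rpow, mul_one] at this
    exact ne_top_of_le_ne_top hD_top this
  have hconv : ∀ᵐ ω ∂μ, ∀ k,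
      Tendsto (blockQuotient p (fun n m => W n m ω) k) atTop (𝓝 0) :=
    ae_all_iff.2 fun k => TailDominated.ae_tendsto_zero hp (hV (2 ^ k)).enorm
      (fun j => hD (2 ^ (k + 1) * j) (2 ^ k)) (hVp k)
  have main : ∀ᵐ ω ∂μ, (∀ n : ℕ, rateQuotient p ψ V (n + 1) ω ≤ (X ω).toReal) ∧ X ω ≠ ∞ ∧
      Tendsto (fun n : ℕ => rateQuotient p ψ V n ω) atTop (𝓝 0) := by
    filter_upwards [h0, ae_all_iff.2 fun n => ae_all_iff.2 fun m => hadd n m,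
      ae_lt_top' hXm hXint, hconv] with ω h0ω haddω hXω hcω
    have := chain_rate hp hψ_pos hψ_mono (v := fun n => V n ω) (w := fun n m => W n m ω)
      h0ω haddω hXω.ne hcω
    exact ⟨fun n => this.1 (n + 1) (by omega), hXω.ne, this.2⟩
  have hrate0 : ∀ n ω, 0 ≤ rateQuotient p ψ V (n + 1) ω := by
    intro n ω
    have := hψ_pos ((n + 1 : ℕ) : ℝ) (by exact_mod_cast Nat.succ_pos n)
    rw [rateQuotient]
    positivity
  have hF0 : ∀ ω, 0 ≤ ⨆ n : ℕ, rateQuotient p ψ V (n + 1) ω :=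
    fun ω => Real.iSup_nonneg fun n => hrate0 n ω
  have hFX : ∀ᵐ ω ∂μ, ‖⨆ n : ℕ, rateQuotient p ψ V (n + 1) ω‖ ≤ (X ω).toReal := by
    filter_upwards [main] with ω hω
    rw [Real.norm_of_nonneg (hF0 ω)]
    exact ciSup_le hω.1
  refine ⟨?_, ⟨?_, ?_⟩, ?_⟩
  · filter_upwards [main] with ω hω
    exact ⟨_, Set.forall_mem_range.2 hω.1⟩
  · refine (integrable_toReal_of_lintegral_ne_top hXm hXint).mono' ?_ hFX
    exact (AEMeasurable.iSup fun n => (hV (n + 1)).norm.aemeasurable.div_const _).aestronglyMeasurable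
  · refine lt_of_le_of_lt (iSup₂_le fun t ht => ?_)
      (ENNReal.rpow_lt_top_of_nonneg hp0.le hD_top)
    rw [← ENNReal.ofReal_rpow_of_pos ht]
    refine le_trans ?_ (weak_of_setLIntegral_le hp hXm hXA (ENNReal.ofReal t))
    gcongr _ * ?_
    refine measure_mono_ae ?_
    filter_upwards [main, hFX] with ω hω hFω hmem
    exact ENNReal.ofReal_le_of_le_toReal (le_trans hmem hFω)
  · filter_upwards [main] with ω hω
    exact hω.2.2

end Rate

/-! ### Tail domination for Dunford–Schwartz operators and for measure-preserving maps. -/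

section Operators

variable {μ : Measure Ω}

theorem IsDunfordSchwartz.pow {T : Lp ℝ 1 μ →L[ℝ] Lp ℝ 1 μ} (hT : IsDunfordSchwartz μ T) (n : ℕ) :
    IsDunfordSchwartz μ (T ^ n) := by
  induction n with
  | zero => exact ⟨fun f => le_rfl, fun f => le_rfl⟩
  | succ n ih =>
    rw [pow_succ]
    exact ⟨fun f => (ih.contraction_one (T f)).trans (hT.contraction_one f),
      fun f => (ih.contraction_top (T f)).trans (hT.contraction_top f)⟩

/-- Truncation at a level `t` bounds the tails of the image under a Dunford–Schwartz operator. -/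
theorem IsDunfordSchwartz.tailDominated [IsFiniteMeasure μ] {T : Lp ℝ 1 μ →L[ℝ] Lp ℝ 1 μ}
    (hT : IsDunfordSchwartz μ T) (g : Lp ℝ 1 μ) :
    TailDominated μ (fun ω => ‖T g ω‖ₑ) (fun ω => ‖g ω‖ₑ) := by
  intro t ht0 ht1
  obtain ⟨s, hs, rfl⟩ : ∃ s : ℝ, 0 < s ∧ t = ENNReal.ofReal s :=
    ⟨t.toReal, ENNReal.toReal_pos ht0 ht1, (ENNReal.ofReal_toReal ht1).symm⟩
  -- The truncation `g₂` of `g` to `[-s, s]` keeps `|T g₂| ≤ s` almost everywhere. Thus `|T g| ≥ 2s`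
  -- forces `|T (g - g₂)| ≥ s`, and Markov with the `L¹` contraction applies to `g - g₂`, which
  -- lives where `|g| > s`.
  have hcont : Continuous fun x : ℝ => max (-s) (min s x) := by fun_prop
  have hbd : ∀ x : ℝ, ‖max (-s) (min s x)‖ ≤ s := fun x => by
    rw [Real.norm_eq_abs, abs_le]
    exact ⟨le_max_left _ _, max_le (by linarith) (min_le_left _ _)⟩
  have hmem : MemLp (fun ω => max (-s) (min s (g ω))) 1 μ :=
    MemLp.of_bound (hcont.comp_aestronglyMeasurable (Lp.aestronglyMeasurable g)) s
      (Eventually.of_forall fun ω => hbd _)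
  set g₂ : Lp ℝ 1 μ := hmem.toLp _ with hg₂
  have hg₂_ae : g₂ =ᵐ[μ] fun ω => max (-s) (min s (g ω)) := hmem.coeFn_toLp
  have hTg₂ : ∀ᵐ ω ∂μ, ‖T g₂ ω‖ₑ ≤ ENNReal.ofReal s := by
    have h1 : eLpNorm (T g₂) ∞ μ ≤ ENNReal.ofReal s := by
      refine (hT.contraction_top g₂).trans ?_
      rw [eLpNorm_exponent_top]
      refine eLpNormEssSup_le_of_ae_bound ?_
      filter_upwards [hg₂_ae] with ω hω
      rw [hω]; exact hbd _
    rw [eLpNorm_exponent_top] at h1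
    filter_upwards [ae_le_eLpNormEssSup (f := T g₂) (μ := μ)] with ω hω
    exact hω.trans h1
  have hsub : ∀ᵐ ω ∂μ, T g ω = T (g - g₂) ω + T g₂ ω := by
    have : T g = T (g - g₂) + T g₂ := by rw [map_sub, sub_add_cancel]
    have h2 := Lp.coeFn_add (T (g - g₂)) (T g₂)
    rw [← this] at h2
    exact h2
  have hdiff : ∀ᵐ ω ∂μ, ‖(g - g₂) ω‖ₑ ≤
      {x | ENNReal.ofReal s < ‖g x‖ₑ}.indicator (fun x => ‖g x‖ₑ) ω := by
    filter_upwards [Lp.coeFn_sub g g₂, hg₂_ae] with ω h1 h2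
    rw [h1, Pi.sub_apply, h2]
    simp only [Set.indicator_apply, Set.mem_ofPred_eq]
    split_ifs with hlt
    · rw [← ofReal_norm, ← ofReal_norm, Real.norm_eq_abs, Real.norm_eq_abs]
      refine ENNReal.ofReal_le_ofReal ?_
      grind
    · rw [not_lt, ← ofReal_norm, ENNReal.ofReal_le_ofReal_iff hs.le, Real.norm_eq_abs, abs_le] at hlt
      rw [min_eq_right hlt.2, max_eq_right hlt.1]; simp
  calc μ {ω | 2 * ENNReal.ofReal s ≤ ‖T g ω‖ₑ}
      ≤ μ {ω | ENNReal.ofReal s ≤ ‖T (g - g₂) ω‖ₑ} := by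
        refine measure_mono_ae ?_
        filter_upwards [hTg₂, hsub] with ω h1 h2 h3
        change 2 * ENNReal.ofReal s ≤ ‖T g ω‖ₑ at h3
        change ENNReal.ofReal s ≤ ‖T (g - g₂) ω‖ₑ
        rw [h2, two_mul] at h3
        have h4 := h3.trans ((enorm_add_le _ _).trans (add_le_add_right h1 _))
        exact (ENNReal.add_le_add_iff_right ht1).1 h4
    _ ≤ (∫⁻ ω, ‖T (g - g₂) ω‖ₑ ∂μ) / ENNReal.ofReal s :=
        meas_ge_le_lintegral_div (Lp.aestronglyMeasurable _).enorm ht0 ht1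
    _ ≤ (∫⁻ ω, ‖(g - g₂) ω‖ₑ ∂μ) / ENNReal.ofReal s := by
        gcongr ?_ / _
        rw [← eLpNorm_one_eq_lintegral_enorm, ← eLpNorm_one_eq_lintegral_enorm, ← Lp.enorm_def,
          ← Lp.enorm_def, ← ofReal_norm, ← ofReal_norm]
        exact ENNReal.ofReal_le_ofReal (hT.contraction_one _)
    _ ≤ (∫⁻ ω, {x | ENNReal.ofReal s < ‖g x‖ₑ}.indicator (fun x => ‖g x‖ₑ) ω ∂μ) /
          ENNReal.ofReal s := by
        gcongr ?_ / _
        exact lintegral_mono_ae hdiff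
    _ = _ := by
        simp only [div_eq_mul_inv]
        rw [← lintegral_mul_const' _ _ (by simpa using hs)]
        refine lintegral_congr fun ω => ?_
        simp only [Set.indicator_apply]
        split_ifs <;> simp

theorem partialSum_add (T : Lp ℝ 1 μ →L[ℝ] Lp ℝ 1 μ) (f : Lp ℝ 1 μ) (n m : ℕ) :
    partialSum T f (n + m) = partialSum T f n + (T ^ n) (partialSum T f m) := by
  simp only [partialSum, Finset.sum_range_add, map_sum, pow_add]
  rfl

/-- Composition preserves the distribution of `‖g‖`, so no truncation is needed: where `‖g‖ ≥ 2t`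
the integrand already exceeds `1`. -/
theorem tailDominated_comp {E : Type*} [NormedAddCommGroup E] {g : Ω → E}
    (hg : AEStronglyMeasurable g μ) {τ : Ω → Ω} (hτ : MeasurePreserving τ μ μ) :
    TailDominated μ (fun ω => ‖g (τ ω)‖ₑ) (fun ω => ‖g ω‖ₑ) := by
  intro t ht0 ht1
  have hn : NullMeasurableSet {ω | 2 * t ≤ ‖g ω‖ₑ} μ :=
    nullMeasurableSet_le aemeasurable_const hg.enorm
  calc μ {ω | 2 * t ≤ ‖g (τ ω)‖ₑ} = μ {ω | 2 * t ≤ ‖g ω‖ₑ} := hτ.measure_preimage hn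
    _ = ∫⁻ ω, {ω | 2 * t ≤ ‖g ω‖ₑ}.indicator 1 ω ∂μ := (lintegral_indicator_one₀ hn).symm
    _ ≤ _ := by
        refine lintegral_mono fun ω => ?_
        refine Set.indicator_le (fun x hx => ?_) ω
        change 2 * t ≤ ‖g x‖ₑ at hx
        have hlt : t < 2 * t := by
          rw [two_mul]; exact ENNReal.lt_add_right ht1 ht0
        rw [Set.indicator_of_mem (show x ∈ {x | t < ‖g x‖ₑ} from hlt.trans_le hx), Pi.one_apply,
          ENNReal.le_div_iff_mul_le (Or.inl ht0) (Or.inl ht1), one_mul]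
        exact hlt.le.trans hx

end Operators

end DunfordSchwartz

/-! ### The theorem, as two instances of `rate_of_tailDominated`. -/

theorem mainTheorem3 {Ω : Type*} [MeasurableSpace Ω] (μ : Measure Ω) [IsProbabilityMeasure μ]
    (p : ℝ) (hp : 1 < p) (ψ : ℝ → ℝ)
    (hψ_pos : ∀ x, 1 ≤ x → 0 < ψ x) (hψ_mono : MonotoneOn ψ (Set.Ici 1))
    (hψ_doubling : ∃ C : ℝ, 1 < C ∧ ∀ x, 1 ≤ x → ψ (2 * x) ≤ C * ψ x) :
    (∀ T : Lp ℝ 1 μ →L[ℝ] Lp ℝ 1 μ, IsDunfordSchwartz μ T →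
      ∀ f : Lp ℝ 1 μ, MemLp f (ENNReal.ofReal p) μ →
      SummableNorms μ p ψ (fun n => partialSum T f n) →
        (∀ᵐ ω ∂μ, BddAbove (Set.range fun n : ℕ =>
          rateQuotient p ψ (fun n => partialSum T f n) (n + 1) ω)) ∧
        MemWeakLp μ p (fun ω => ⨆ n : ℕ,
          rateQuotient p ψ (fun n => partialSum T f n) (n + 1) ω) ∧
        ∀ᵐ ω ∂μ, Tendsto (fun n : ℕ => rateQuotient p ψ (fun n => partialSum T f n) n ω)
          atTop (𝓝 0)) ∧
    (∀ (B : Type*) [NormedAddCommGroup B] [NormedSpace ℝ B] [CompleteSpace B]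
      (θ : Ω → Ω), MeasurePreserving θ μ μ →
      ∀ f : Ω → B, MemLp f (ENNReal.ofReal p) μ →
      SummableNorms μ p ψ (fun n => birkhoffSum θ f n) →
        (∀ᵐ ω ∂μ, BddAbove (Set.range fun n : ℕ =>
          rateQuotient p ψ (fun n => birkhoffSum θ f n) (n + 1) ω)) ∧
        MemWeakLp μ p (fun ω => ⨆ n : ℕ,
          rateQuotient p ψ (fun n => birkhoffSum θ f n) (n + 1) ω) ∧
        ∀ᵐ ω ∂μ, Tendsto (fun n : ℕ => rateQuotient p ψ (fun n => birkhoffSum θ f n) n ω)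
          atTop (𝓝 0)) := by
  refine ⟨fun T hT f _ hsum => ?_, fun B _ _ _ θ hθ f hf hsum => ?_⟩
  · refine rate_of_tailDominated hp hψ_pos hψ_mono
      (W := fun n m => ((T ^ n) (partialSum T f m) : Lp ℝ 1 μ))
      (fun n => Lp.aestronglyMeasurable _) (fun n m => Lp.aestronglyMeasurable _) ?_
      (fun n m => ?_) (fun n m => (hT.pow n).tailDominated _) hsum
    · simp only [partialSum, Finset.range_zero, Finset.sum_empty]
      exact Lp.coeFn_zero _ _ _
    · rw [partialSum_add]
      exact Lp.coeFn_add _ _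
  · have hS : ∀ n, AEStronglyMeasurable (birkhoffSum θ f n) μ := fun n => by
      have : birkhoffSum θ f n = ∑ k ∈ Finset.range n, f ∘ θ^[k] := by
        ext ω; simp [birkhoffSum]
      rw [this]
      exact Finset.aestronglyMeasurable_sum _ fun k _ =>
        hf.1.comp_measurePreserving (hθ.iterate k)
    refine rate_of_tailDominated hp hψ_pos hψ_mono
      (W := fun n m ω => birkhoffSum θ f m (θ^[n] ω)) hS
      (fun n m => (hS m).comp_measurePreserving (hθ.iterate n)) ?_
      (fun n m => ?_) (fun n m => tailDominated_comp (hS m) (hθ.iterate n)) hsum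
    · rw [birkhoffSum_zero']
    · exact Eventually.of_forall fun ω => birkhoffSum_add θ f n m ω
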